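/- Let $\mathfrak H$ be a real or complex Hilbert space with norm $|\cdot|_2$ and real scalar product $\langle\cdot,\cdot\rangle_{\mathrm{real}}=\operatorname{Re}\langle\cdot,\cdot\rangle$, and let $\|\cdot\|_2$ be the operator norm. For $\mathbf x,\mathbf y\in\mathfrak H$, $\mathbf x\neq0$, put $$\mathbf y:\mathbf x=\frac{\langle\mathbf y,\mathbf x\rangle_{\mathrm{real}}}{|\mathbf x|_2^2}+\mathrm i\left|\frac{\mathbf y}{|\mathbf x|_2}-\frac{\langle\mathbf y,\mathbf x\rangle_{\mathrm{real}}}{|\mathbf x|_2^2}\frac{\mathbf x}{|\mathbf x|_2}\right|_2 ,$$ and for a bounded linear operator $A$ on $\mathfrak H$ let its conformal range be $$\mathrm{CR}(A)=\{A\mathbf x:\mathbf x,\ \overline{(A\mathbf x:\mathbf x)}\ ;\ \mathbf x\in\mathfrak H\setminus\{0\}\}\subset\mathbb C .$$ The logarithm of $A$ is well-defined if $(1-t)\mathrm{Id}+tA$ is invertible for all $t\in[0,1]$, and then $\log A=\int_0^1 (A-\mathrm{Id})\,((1-t)\mathrm{Id}+tA)^{-1}\,\mathrm dt$. Let $\overline{\mathrm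 D}(0,p)=\{z\in\mathbb C: |z|\le p\}$. Theorem. Let $0<p<\pi$. If $\mathrm{CR}(A)\subset\exp\overline{\mathrm D}(0,p)$, then $\log A$ is well-defined and $$\|\log A\|_2\le H(p),$$ where $$H(p)=p-2\log\left(2\cosh\frac p2-\frac2p\sinh\frac p2\right)+\int_0^\pi HH(p,t)\,\mathrm dt$$ with $$HH(p,t)=\frac{(\sin(p\sin t)-(p\sin t)\cos(p\sin t))\,(\mathrm e^{p\cos t}+\mathrm e^{-p\cos t}-2\cos(p\sin t))}{\sin(p\sin t)\,(2\sin t+\mathrm e^{p\cos t}\sin(-t+p\sin t)-\mathrm e^{-p\cos t}\sin(t+p\sin t))}.$$ For $0<p<\pi$, $HH(p,t)$ is finite (its denominator does not vanish) and positive for all $t\in(0,\pi)$, it is integrable in $t$ over $[0,\pi]$, the argument of the logarithm in $H(p)$ is positive, and $H(p)$ is finite and positive. The estimate extends to $p=0$ with $H(0)=0$: if $\mathrm{CR}(A)\subset\exp\overline{\mathrm D}(0,0)=\{1\}$, then $\log A$ is well-defined and $\|\log A\|_2\le 0$. -/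

import Mathlib

namespace ConformalRange

noncomputable section

variable {𝕜 E : Type*} [RCLike 𝕜] [NormedAddCommGroup E] [InnerProductSpace 𝕜 E]

/-- The real scalar product `⟨y, x⟩_real = Re ⟨y, x⟩` underlying the scalar product of `E`. -/
def realInner (𝕜 : Type*) {E : Type*} [RCLike 𝕜] [NormedAddCommGroup E]
    [InnerProductSpace 𝕜 E] (y x : E) : ℝ :=
  RCLike.re (inner 𝕜 y x)

/-- The complex number `y : x` (meant for `x ≠ 0`), which records the real orthogonal
decomposition of `y` with respect to `x`:
`⟨y,x⟩_real / |x|² + i | y/|x| - (⟨y,x⟩_real / |x|²) x/|x| |`. -/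
def ratio (𝕜 : Type*) {E : Type*} [RCLike 𝕜] [NormedAddCommGroup E]
    [InnerProductSpace 𝕜 E] (y x : E) : ℂ :=
  ⟨realInner 𝕜 y x / ‖x‖ ^ 2,
    ‖((‖x‖⁻¹ : ℝ) : 𝕜) • y
      - ((realInner 𝕜 y x / ‖x‖ ^ 2 : ℝ) : 𝕜) • (((‖x‖⁻¹ : ℝ) : 𝕜) • x)‖⟩

/-- The conformal range: all `Ax : x` and their complex conjugates, for `x ≠ 0`. -/
def conformalRange (A : E →L[𝕜] E) : Set ℂ :=
  {z | ∃ x : E, x ≠ 0 ∧ (z = ratio 𝕜 (A x) x ∨ z = starRingEnd ℂ (ratio 𝕜 (A x) x))}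

/-- The point `(1 - t) Id + t A` of the segment from `Id` to `A`. -/
def segmentPoint (A : E →L[𝕜] E) (t : ℝ) : E →L[𝕜] E :=
  ((1 - t : ℝ) : 𝕜) • (1 : E →L[𝕜] E) + (t : 𝕜) • A

/-- `log A` is well defined: the segment from `Id` to `A` contains only invertible operators
(equivalently, the spectrum of `A` does not meet `(-∞, 0]`). -/
def IsLogable (A : E →L[𝕜] E) : Prop :=
  ∀ t ∈ Set.Icc (0 : ℝ) 1, IsUnit (segmentPoint A t)

/-- The principal logarithm `log A = ∫_0^1 (A - Id) ((1 - t) Id + t A)⁻¹ dt`, a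
Bochner integral in the (real) Banach space of bounded operators. -/
def opLog (A : E →L[𝕜] E) : E →L[𝕜] E :=
  letI : NormedSpace ℝ (E →L[𝕜] E) := NormedSpace.restrictScalars ℝ 𝕜 (E →L[𝕜] E)
  ∫ t in (0 : ℝ)..1, (A - 1) * Ring.inverse (segmentPoint A t)

open Real in
/-- The denominator of the kernel `HH`. -/
def HHden (p t : ℝ) : ℝ :=
  sin (p * sin t) *
    (2 * sin t + exp (p * cos t) * sin (-t + p * sin t)
      - exp (-(p * cos t)) * sin (t + p * sin t))

open Real in
/-- The kernel `HH(p, t)`. -/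
def HH (p t : ℝ) : ℝ :=
  (sin (p * sin t) - p * sin t * cos (p * sin t)) *
    (exp (p * cos t) + exp (-(p * cos t)) - 2 * cos (p * sin t)) / HHden p t

open Real in
/-- The argument of the logarithm in `H(p)`. -/
def HlogArg (p : ℝ) : ℝ :=
  2 * cosh (p / 2) - 2 / p * sinh (p / 2)

/-- The growth function `H(p)`. -/
def H (p : ℝ) : ℝ :=
  p - 2 * Real.log (HlogArg p) + ∫ t in (0 : ℝ)..Real.pi, HH p t

end

end ConformalRange

/-!
Put `τ = 2 t - 1`. For a complex number `w`,
`2 ((1 - t) + t exp w) = (exp w - 1) (τ - ζ w)` with `ζ w = -coth (w / 2)`. If the conformal range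
of `A` lies in the image of the disc `|w| ≤ p`, the ratio of `|(A - 1) x|` to
`|((1 - t) + t A) x|` is the modulus of the holomorphic function
`(exp w - 1) / ((1 - t) + t exp w)` at some `w` of that disc. By the maximum principle it is at most
`2 / ρ(τ)`, where `ρ(τ)` is the distance from `τ` to the curve `ζ(|w| = p)`; hence
`‖log A‖ ≤ ∫ dτ / ρ(τ)` over `[-1, 1]`.

This integral is exactly `H(p)`. The normal to the curve at `ζ(p e^{iθ})` meets the real line in a
point which increases with `θ ∈ [0, π]`, and the curve point nearest to that foot is
`ζ(p e^{iθ})` or its conjugate. Substituting `τ = foot(θ)` between the extreme feet gives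
`∫ HH(p, θ) dθ`. On each of the two remaining end intervals the nearest point is the real one,
`θ = 0` or `θ = π`, so `ρ` is affine there, and the interval contributes
`p / 2 - log (2 cosh (p / 2) - (2 / p) sinh (p / 2))`.
-/

namespace ConformalRange

noncomputable section

open Real Set

/-! ### Invertibility along paths of operators -/

section ContinuityMethod

variable {𝕜 F : Type*} [NontriviallyNormedField 𝕜] [NormedAddCommGroup F] [NormedSpace 𝕜 F]

theorem norm_units_inv_le_inv {T : (F →L[𝕜] F)ˣ} {c : ℝ} (hc : 0 < c)
    (hT : ∀ x, c * ‖x‖ ≤ ‖(T : F →L[𝕜] F) x‖) : ‖(↑T⁻¹ : F →L[𝕜] F)‖ ≤ c⁻¹ := by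
  refine ContinuousLinearMap.opNorm_le_bound _ (inv_nonneg.2 hc.le) fun y => ?_
  have hy := hT ((↑T⁻¹ : F →L[𝕜] F) y)
  rw [← mul_apply_eq_comp, T.mul_inv, one_apply_eq_self] at hy
  rwa [inv_mul_eq_div, le_div_iff₀' hc]

theorem isUnit_of_norm_sub_lt [CompleteSpace F] {S T : F →L[𝕜] F} {c : ℝ} (hT : IsUnit T)
    (hc : ∀ x, c * ‖x‖ ≤ ‖T x‖) (hST : ‖S - T‖ < c) : IsUnit S := by
  rcases subsingleton_or_nontrivial F with hF | hF
  · exact isUnit_of_subsingleton S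
  obtain ⟨T, rfl⟩ := hT
  have hinv := norm_units_inv_le_inv ((norm_nonneg _).trans_lt hST) hc
  exact (T.ofNearby S <|
    hST.trans_le <| le_inv_of_le_inv₀ (norm_pos_iff.2 T⁻¹.ne_zero) hinv).isUnit

theorem isUnit_of_isPreconnected [CompleteSpace F] {X : Type*} [TopologicalSpace X] {s : Set X}
    (hs : IsPreconnected s) {T : X → F →L[𝕜] F} (hT : Continuous T) {c : ℝ} (hc : 0 < c)
    (hbelow : ∀ t ∈ s, ∀ x, c * ‖x‖ ≤ ‖T t x‖) {t₀ : X} (ht₀ : t₀ ∈ s) (hunit : IsUnit (T t₀))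
    {t : X} (ht : t ∈ s) : IsUnit (T t) := by
  have hopen : IsOpen {t | IsUnit (T t)} := Units.isOpen.preimage hT
  refine hs.subset_of_closure_inter_subset hopen ⟨t₀, ht₀, hunit⟩ (fun r ⟨hr, hrs⟩ => ?_) ht
  obtain ⟨q, hq, hqunit⟩ := mem_closure_iff_nhds.1 hr _
    (hT.continuousAt.preimage_mem_nhds (Metric.ball_mem_nhds _ (half_pos hc)))
  have hqr : ‖T r - T q‖ < c / 2 := by
    rwa [mem_preimage, Metric.mem_ball, dist_eq_norm, norm_sub_rev] at hq
  refine isUnit_of_norm_sub_lt hqunit (fun x => ?_) hqr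
  have hdiff : ‖T r x - T q x‖ ≤ c / 2 * ‖x‖ := (T r - T q).le_of_opNorm_le hqr.le x
  linarith [hbelow r hrs x, norm_sub_norm_le (T r x) (T q x)]

end ContinuityMethod

/-! ### The conformal range and the operator logarithm -/

section Operator

variable {𝕜 E : Type*} [RCLike 𝕜] [NormedAddCommGroup E] [InnerProductSpace 𝕜 E]

theorem norm_smul_add_smul_sq (a b : ℝ) (x y : E) :
    ‖(a : 𝕜) • x + (b : 𝕜) • y‖ ^ 2
      = a ^ 2 * ‖x‖ ^ 2 + 2 * a * b * realInner 𝕜 y x + b ^ 2 * ‖y‖ ^ 2 := by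
  rw [@norm_add_sq 𝕜, norm_smul, norm_smul, inner_smul_left, inner_smul_right, RCLike.norm_ofReal,
    RCLike.norm_ofReal, RCLike.conj_ofReal, mul_pow, mul_pow, sq_abs, sq_abs, realInner,
    RCLike.re_ofReal_mul, RCLike.re_ofReal_mul, inner_re_symm]
  ring

theorem ratio_im_sq {x : E} (hx : x ≠ 0) (y : E) :
    (ratio 𝕜 y x).im ^ 2 = ‖y‖ ^ 2 / ‖x‖ ^ 2 - (ratio 𝕜 y x).re ^ 2 := by
  have hx' : ‖x‖ ≠ 0 := norm_ne_zero_iff.2 hx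
  have him : (ratio 𝕜 y x).im =
      ‖((-(realInner 𝕜 y x / ‖x‖ ^ 2 * ‖x‖⁻¹) : ℝ) : 𝕜) • x + ((‖x‖⁻¹ : ℝ) : 𝕜) • y‖ := by
    rw [ratio, smul_smul, sub_eq_neg_add, ← neg_smul]
    push_cast
    rfl
  rw [him, norm_smul_add_smul_sq, ratio]
  field_simp
  ring

theorem norm_smul_add_smul (a b : ℝ) {x : E} (hx : x ≠ 0) (y : E) :
    ‖(a : 𝕜) • x + (b : 𝕜) • y‖ = ‖(a + b * ratio 𝕜 y x : ℂ)‖ * ‖x‖ := by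
  have hx' : ‖x‖ ≠ 0 := norm_ne_zero_iff.2 hx
  have hre : (ratio 𝕜 y x).re * ‖x‖ ^ 2 = realInner 𝕜 y x := div_mul_cancel₀ _ (pow_ne_zero 2 hx')
  have him : (ratio 𝕜 y x).im ^ 2 * ‖x‖ ^ 2 = ‖y‖ ^ 2 - (ratio 𝕜 y x).re ^ 2 * ‖x‖ ^ 2 := by
    rw [ratio_im_sq hx]
    field_simp
  refine (sq_eq_sq₀ (norm_nonneg _) (by positivity)).1 ?_
  rw [norm_smul_add_smul_sq, mul_pow, Complex.sq_norm, Complex.normSq_apply]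
  simp only [Complex.add_re, Complex.add_im, Complex.ofReal_re, Complex.ofReal_im,
    Complex.re_ofReal_mul, Complex.im_ofReal_mul, zero_add]
  linear_combination (-2 * a * b) * hre - b ^ 2 * him

theorem ratio_mem_conformalRange (A : E →L[𝕜] E) {x : E} (hx : x ≠ 0) :
    ratio 𝕜 (A x) x ∈ conformalRange A := ⟨x, hx, Or.inl rfl⟩

theorem norm_segmentPoint_apply (A : E →L[𝕜] E) (t : ℝ) {x : E} (hx : x ≠ 0) :
    ‖segmentPoint A t x‖ = ‖(1 - t + t * ratio 𝕜 (A x) x : ℂ)‖ * ‖x‖ := by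
  have h := norm_smul_add_smul (𝕜 := 𝕜) (1 - t) t hx (A x)
  push_cast at h
  simpa [segmentPoint] using h

theorem norm_sub_one_apply (A : E →L[𝕜] E) {x : E} (hx : x ≠ 0) :
    ‖(A - 1) x‖ = ‖ratio 𝕜 (A x) x - 1‖ * ‖x‖ := by
  simpa [sub_eq_neg_add] using norm_smul_add_smul (𝕜 := 𝕜) (-1) 1 hx (A x)

theorem continuous_segmentPoint (A : E →L[𝕜] E) : Continuous (segmentPoint A) := by
  have hcoe : Continuous ((↑) : ℝ → 𝕜) := RCLike.continuous_ofReal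
  exact ((hcoe.comp (continuous_sub_left 1)).smul continuous_const).add
    (hcoe.smul continuous_const)

theorem isLogable_of_bounded_below [CompleteSpace E] (A : E →L[𝕜] E) {c : ℝ} (hc : 0 < c)
    (hA : ∀ t ∈ Icc (0 : ℝ) 1, ∀ x, c * ‖x‖ ≤ ‖segmentPoint A t x‖) : IsLogable A := fun _ ht =>
  isUnit_of_isPreconnected isPreconnected_Icc (continuous_segmentPoint A) hc hA
    (left_mem_Icc.2 zero_le_one) (by simp [segmentPoint]) ht

theorem norm_opLog_le (A : E →L[𝕜] E) (hA : IsLogable A) {B : ℝ → ℝ}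
    (hB : IntervalIntegrable B MeasureTheory.volume 0 1) (hB0 : ∀ t ∈ Icc (0 : ℝ) 1, 0 ≤ B t)
    (hle : ∀ t ∈ Icc (0 : ℝ) 1, ∀ x, ‖(A - 1) x‖ ≤ B t * ‖segmentPoint A t x‖) :
    ‖opLog A‖ ≤ ∫ t in (0 : ℝ)..1, B t := by
  let _ : NormedSpace ℝ (E →L[𝕜] E) := NormedSpace.restrictScalars ℝ 𝕜 (E →L[𝕜] E)
  refine intervalIntegral.norm_integral_le_of_norm_le zero_le_one
    (Filter.Eventually.of_forall fun t ht => ?_) hB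
  have ht' := Ioc_subset_Icc_self ht
  refine ContinuousLinearMap.opNorm_le_bound _ (hB0 t ht') fun y => ?_
  have hy := hle t ht' (Ring.inverse (segmentPoint A t) y)
  rwa [← mul_apply_eq_comp, ← mul_apply_eq_comp, Ring.mul_inverse_cancel _ (hA t ht'),
    one_apply_eq_self] at hy

theorem isLogable_one : IsLogable (1 : E →L[𝕜] E) := fun t _ => by
  have hone : segmentPoint (1 : E →L[𝕜] E) t = 1 := by
    rw [segmentPoint, ← add_smul]
    push_cast
    rw [sub_add_cancel, one_smul]
  rw [hone]
  exact isUnit_one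

theorem opLog_one : opLog (1 : E →L[𝕜] E) = 0 := by
  simp [opLog]

theorem eq_one_of_conformalRange_subset (A : E →L[𝕜] E) (hA : conformalRange A ⊆ {1}) :
    A = 1 := by
  ext x
  rcases eq_or_ne x 0 with rfl | hx
  · simp
  have hratio : ratio 𝕜 (A x) x = 1 := hA (ratio_mem_conformalRange A hx)
  have hnorm := norm_sub_one_apply A hx
  rw [hratio, sub_self, norm_zero, zero_mul, norm_eq_zero] at hnorm
  exact sub_eq_zero.1 hnorm

end Operator

/-! ### Elementary inequalities -/

theorem mul_sinc (x : ℝ) : x * sinc x = sin x := by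
  rcases eq_or_ne x 0 with rfl | hx
  · simp
  · rw [sinc_of_ne_zero hx, mul_div_cancel₀ _ hx]

theorem sinc_abs (x : ℝ) : sinc |x| = sinc x := by
  rcases abs_choice x with h | h <;> simp only [h, sinc_neg]

theorem sinc_pos {x : ℝ} (hx : |x| < π) : 0 < sinc x := by
  rcases eq_or_ne x 0 with rfl | hx0
  · simp
  · rw [← sinc_abs, sinc_of_ne_zero (abs_ne_zero.2 hx0)]
    exact div_pos (sin_pos_of_pos_of_lt_pi (abs_pos.2 hx0) hx) (abs_pos.2 hx0)

theorem cos_lt_sinc {x : ℝ} (hx0 : x ≠ 0) (hx : |x| < π) : cos x < sinc x := by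
  have hpos : 0 < |x| := abs_pos.2 hx0
  obtain ⟨y, ⟨hy0, hyx⟩, hy⟩ := exists_deriv_eq_slope sin hpos continuousOn_sin
    differentiable_sin.differentiableOn
  rw [Real.deriv_sin, sin_zero, sub_zero, sub_zero, ← sinc_of_ne_zero hpos.ne', sinc_abs] at hy
  rw [← cos_abs, ← hy]
  exact strictAntiOn_cos ⟨hy0.le, (hyx.trans hx).le⟩ ⟨hpos.le, hx.le⟩ hyx

theorem cos_lt_one {x : ℝ} (hx0 : x ≠ 0) (hx : |x| < π) : cos x < 1 :=
  (cos_lt_sinc hx0 hx).trans_le (sinc_le_one x)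

theorem cos_lt_cosh {u v : ℝ} (huv : u ≠ 0 ∨ v ≠ 0) (hv : |v| < π) : cos v < cosh u := by
  rcases huv with hu | hv0
  · exact (cos_le_one v).trans_lt (one_lt_cosh.2 hu)
  · exact (cos_lt_one hv0 hv).trans_le (one_le_cosh u)

theorem cosh_sub_one_lt_mul_sinh {x : ℝ} (hx : x ≠ 0) : cosh x - 1 < x * sinh x := by
  have hpos : 0 < |x| := abs_pos.2 hx
  obtain ⟨y, ⟨-, hyx⟩, hy⟩ := exists_deriv_eq_slope cosh hpos continuous_cosh.continuousOn
    differentiable_cosh.differentiableOn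
  rw [Real.deriv_cosh, cosh_zero, cosh_abs, sub_zero, eq_div_iff hpos.ne'] at hy
  have heven : |x| * sinh |x| = x * sinh x := by
    rcases abs_choice x with h | h <;> simp only [h, sinh_neg, neg_mul_neg]
  rw [← hy, ← heven, mul_comm]
  exact mul_lt_mul_of_pos_left (sinh_strictMono hyx) hpos

/-! ### Zeros of the segments from `1` to `exp w` -/

/-- The zero, in the rescaled variable `τ = 2 * t - 1`, of the affine function
`1 - t + t * exp w`; it equals `-coth (w / 2)`, and has the junk value `0` if `exp w = 1`. -/
def segmentZero (w : ℂ) : ℂ :=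
  (1 + Complex.exp w) / (1 - Complex.exp w)

/-- The squared distance from the real number `τ` to `segmentZero (u + v * I)`, in real terms. -/
def distSq (τ u v : ℝ) : ℝ :=
  τ ^ 2 + (2 * τ * sinh u + cosh u + cos v) / (cosh u - cos v)

/-- The distance from the real number `τ` to the closed curve `segmentZero '' {|w| = p}`. -/
def zeroDist (p τ : ℝ) : ℝ :=
  Metric.infDist (τ : ℂ) (segmentZero '' Metric.sphere 0 p)

theorem segmentZero_neg (w : ℂ) : segmentZero (-w) = -segmentZero w := by
  have hexp := Complex.exp_ne_zero w
  rw [segmentZero, segmentZero, Complex.exp_neg, ← neg_div_neg_eq, ← neg_div,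
    ← mul_div_mul_left _ _ hexp]
  congr 1 <;> field_simp <;> ring

theorem two_mul_segment_exp {w : ℂ} (hw : 1 - Complex.exp w ≠ 0) (t : ℂ) :
    2 * (1 - t + t * Complex.exp w) = (Complex.exp w - 1) * (2 * t - 1 - segmentZero w) := by
  rw [segmentZero]
  field_simp
  ring

theorem normSq_add_mul_exp (a b : ℝ) (w : ℂ) :
    Complex.normSq (a + b * Complex.exp w) = Real.exp w.re *
      ((a ^ 2 + b ^ 2) * cosh w.re + (b ^ 2 - a ^ 2) * sinh w.re + 2 * a * b * cos w.im) := by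
  rw [Complex.normSq_apply]
  simp only [Complex.add_re, Complex.add_im, Complex.ofReal_re, Complex.ofReal_im,
    Complex.re_ofReal_mul, Complex.im_ofReal_mul, Complex.exp_re, Complex.exp_im, zero_add,
    ← cosh_add_sinh]
  linear_combination b ^ 2 * (cosh w.re + sinh w.re) ^ 2 * sin_sq_add_cos_sq w.im
    - a ^ 2 * cosh_sq w.re

theorem normSq_one_sub_exp (w : ℂ) :
    Complex.normSq (1 - Complex.exp w) = 2 * Real.exp w.re * (cosh w.re - cos w.im) := by
  have h := normSq_add_mul_exp 1 (-1) w
  push_cast at h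
  rw [neg_one_mul, ← sub_eq_add_neg] at h
  rw [h]
  ring

theorem one_sub_exp_ne_zero {w : ℂ} (hw : cos w.im < cosh w.re) : 1 - Complex.exp w ≠ 0 := by
  rw [← Complex.normSq_pos, normSq_one_sub_exp]
  exact mul_pos (by positivity) (sub_pos.2 hw)

theorem norm_ofReal_sub_segmentZero_sq (τ : ℝ) {w : ℂ} (hw : cos w.im < cosh w.re) :
    ‖τ - segmentZero w‖ ^ 2 = distSq τ w.re w.im := by
  have hquot : τ - segmentZero w
      = ((τ - 1 : ℝ) + (-(τ + 1) : ℝ) * Complex.exp w) / (1 - Complex.exp w) := by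
    rw [segmentZero, eq_div_iff (one_sub_exp_ne_zero hw), sub_mul,
      div_mul_cancel₀ _ (one_sub_exp_ne_zero hw)]
    push_cast
    ring
  have hne : cosh w.re - cos w.im ≠ 0 := (sub_pos.2 hw).ne'
  rw [hquot, Complex.sq_norm, Complex.normSq_div, normSq_one_sub_exp, normSq_add_mul_exp, distSq]
  field_simp
  ring

theorem continuous_zeroDist (p : ℝ) : Continuous (zeroDist p) :=
  (Metric.continuous_infDist_pt _).comp Complex.continuous_ofReal

theorem zeroDist_neg (p τ : ℝ) : zeroDist p (-τ) = zeroDist p τ := by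
  have hsphere : (fun w : ℂ => -w) '' Metric.sphere 0 p = Metric.sphere 0 p := by
    simp
  have himage : (fun z : ℂ => -z) '' (segmentZero '' Metric.sphere 0 p)
      = segmentZero '' Metric.sphere 0 p := by
    conv_rhs => rw [← hsphere]
    simp only [image_image, segmentZero_neg]
  rw [zeroDist, ← himage, Complex.ofReal_neg]
  exact Metric.infDist_image isometry_neg

theorem norm_exp_sub_one_mul_zeroDist_le_of_mem_sphere {p : ℝ} {w : ℂ}
    (hw : w ∈ Metric.sphere 0 p) (t : ℝ) :
    ‖Complex.exp w - 1‖ * zeroDist p (2 * t - 1) ≤ 2 * ‖(1 - t + t * Complex.exp w : ℂ)‖ := by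
  rcases eq_or_ne (1 - Complex.exp w) 0 with h1 | h1
  · rw [norm_sub_rev, h1, norm_zero, zero_mul]
    positivity
  have hle : zeroDist p (2 * t - 1) ≤ ‖(2 * t - 1 - segmentZero w : ℂ)‖ := by
    have h := Metric.infDist_le_dist_of_mem (x := ((2 * t - 1 : ℝ) : ℂ))
      (mem_image_of_mem segmentZero hw)
    rw [dist_eq_norm] at h
    exact_mod_cast h
  calc ‖Complex.exp w - 1‖ * zeroDist p (2 * t - 1)
      ≤ ‖Complex.exp w - 1‖ * ‖(2 * t - 1 - segmentZero w : ℂ)‖ := by gcongr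
    _ = ‖2 * (1 - t + t * Complex.exp w : ℂ)‖ := by rw [two_mul_segment_exp h1, norm_mul]
    _ = 2 * ‖(1 - t + t * Complex.exp w : ℂ)‖ := by rw [norm_mul, Complex.norm_two]

/-! ### Normals to the curve of zeros -/

/-- The numerator of `normalFoot`, up to the common factor `v`. -/
def normalFootNum (u v : ℝ) : ℝ :=
  cos v * sinh u - u * sinc v * cosh u

/-- The denominator of `normalFoot`, up to the common factor `v`. -/
def normalFootDen (u v : ℝ) : ℝ :=
  1 - cosh u * cos v + u * sinh u * sinc v

/-- The point where the normal at `segmentZero (u + v * I)` to the image under `segmentZero` of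
a circle around `0` meets the real line. Cancelling `v` against `sin v` to get `sinc v` extends
it to `v = 0`. -/
def normalFoot (u v : ℝ) : ℝ :=
  normalFootNum u v / normalFootDen u v

theorem mul_normalFootNum (u v : ℝ) :
    v * normalFootNum u v = v * cos v * sinh u - u * sin v * cosh u := by
  rw [← mul_sinc, normalFootNum]
  ring

theorem mul_normalFootDen (u v : ℝ) :
    v * normalFootDen u v = v * (1 - cosh u * cos v) + u * sinh u * sin v := by
  rw [← mul_sinc, normalFootDen]
  ring

theorem normalFoot_neg (u v : ℝ) : normalFoot (-u) v = -normalFoot u v := by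
  simp only [normalFoot, normalFootNum, normalFootDen, sinh_neg, cosh_neg, neg_mul_neg,
    ← neg_div]
  ring

theorem normalFootDen_pos {u v : ℝ} (huv : u ≠ 0 ∨ v ≠ 0) (hv : |v| < π) :
    0 < normalFootDen u v := by
  have hsplit : normalFootDen u v = (1 - cos v) + (cosh u - 1) * (sinc v - cos v)
      + sinc v * (u * sinh u - (cosh u - 1)) := by
    rw [normalFootDen]
    ring
  have hcosh := sub_nonneg.2 (one_le_cosh u)
  have hsinc := sinc_pos hv
  rw [hsplit]
  rcases eq_or_ne v 0 with rfl | hv0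
  · have hu := cosh_sub_one_lt_mul_sinh (huv.resolve_right (not_not.2 rfl))
    simpa using hu
  · have hle : cosh u - 1 ≤ u * sinh u := by
      rcases eq_or_ne u 0 with rfl | hu
      · simp
      · exact (cosh_sub_one_lt_mul_sinh hu).le
    exact add_pos_of_pos_of_nonneg (add_pos_of_pos_of_nonneg (sub_pos.2 (cos_lt_one hv0 hv))
      (mul_nonneg hcosh (sub_pos.2 (cos_lt_sinc hv0 hv)).le))
      (mul_nonneg hsinc.le (sub_nonneg.2 hle))

theorem distSq_eq_add_sq_div {τ u v : ℝ} (h : cos v < cosh u) :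
    distSq τ u v
      = ((τ * (cosh u - cos v) + sinh u) ^ 2 + sin v ^ 2) / (cosh u - cos v) ^ 2 := by
  have hne : cosh u - cos v ≠ 0 := (sub_pos.2 h).ne'
  rw [distSq]
  field_simp
  linear_combination cosh_sq u - sin_sq_add_cos_sq v

theorem distSq_normalFoot {u v : ℝ} (huv : u ≠ 0 ∨ v ≠ 0) (hv : |v| < π) :
    distSq (normalFoot u v) u v = (u ^ 2 + v ^ 2) * (sinc v / normalFootDen u v) ^ 2 := by
  have hlt := cos_lt_cosh huv hv
  have hne : cosh u - cos v ≠ 0 := (sub_pos.2 hlt).ne'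
  have hden := (normalFootDen_pos huv hv).ne'
  set R := u * (1 - cosh u * cos v) - v * sinh u * sin v with hR
  have hnum : normalFootNum u v * (cosh u - cos v) + normalFootDen u v * sinh u
      = -sinc v * R := by
    rw [hR, normalFootNum, normalFootDen]
    linear_combination u * sinc v * sinh_sq u - sinh u * sin_sq_add_cos_sq v
      - sinh u * sin v * mul_sinc v
  have hmod : R ^ 2 + (v * normalFootDen u v) ^ 2 = (u ^ 2 + v ^ 2) * (cosh u - cos v) ^ 2 := by
    rw [mul_normalFootDen, hR]
    linear_combination (u ^ 2 + v ^ 2) * (sinh u ^ 2 * sin_sq_add_cos_sq v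
      + (1 - cos v ^ 2) * sinh_sq u)
  have hfoot : normalFoot u v * (cosh u - cos v) + sinh u
      = -sinc v * R / normalFootDen u v := by
    rw [← hnum, normalFoot]
    field_simp
  rw [distSq_eq_add_sq_div hlt, hfoot, ← mul_sinc v, div_pow, div_pow]
  field_simp
  linear_combination sinc v ^ 2 * hmod

section Rotation

variable {u v : ℝ → ℝ} {θ : ℝ}

theorem hasDerivAt_distSq (hu : HasDerivAt u (-v θ) θ) (hv : HasDerivAt v (u θ) θ)
    (hlt : cos (v θ) < cosh (u θ)) (τ : ℝ) :
    HasDerivAt (fun s => distSq τ (u s) (v s))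
      (2 * v θ * (normalFootNum (u θ) (v θ) - τ * normalFootDen (u θ) (v θ))
        / (cosh (u θ) - cos (v θ)) ^ 2) θ := by
  have hne : cosh (u θ) - cos (v θ) ≠ 0 := (sub_pos.2 hlt).ne'
  have hderiv := (((hu.sinh.const_mul (2 * τ)).fun_add hu.cosh).fun_add hv.cos).fun_div
    (hu.cosh.fun_sub hv.cos) hne |>.const_add (τ ^ 2)
  refine hderiv.congr_deriv ?_
  congr 1
  linear_combination 2 * τ * mul_normalFootDen (u θ) (v θ) - 2 * mul_normalFootNum (u θ) (v θ)
    - 2 * τ * v θ * cosh_sq (u θ)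

theorem hasDerivAt_normalFoot (hu : HasDerivAt u (-v θ) θ) (hv : HasDerivAt v (u θ) θ)
    (hv0 : v θ ≠ 0) (hvπ : |v θ| < π) :
    HasDerivAt (fun s => normalFoot (u s) (v s))
      ((u θ ^ 2 + v θ ^ 2) * (cosh (u θ) - cos (v θ)) * (sin (v θ) - v θ * cos (v θ))
        / (v θ * normalFootDen (u θ) (v θ)) ^ 2) θ := by
  have hden := mul_ne_zero hv0 (normalFootDen_pos (u := u θ) (.inr hv0) hvπ).ne'
  rw [mul_normalFootDen] at hden ⊢
  have hderiv := (((hv.fun_mul hv.cos).fun_mul hu.sinh).fun_sub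
    ((hu.fun_mul hv.sin).fun_mul hu.cosh)).fun_div ((hv.fun_mul
      ((hu.cosh.fun_mul hv.cos).const_sub 1)).fun_add ((hu.fun_mul hu.sinh).fun_mul hv.sin)) hden
  refine (hderiv.congr_of_eventuallyEq ?_).congr_deriv ?_
  · filter_upwards [hv.continuousAt.eventually_ne hv0] with s hs
    rw [normalFoot, ← mul_div_mul_left _ _ hs, mul_normalFootNum, mul_normalFootDen]
  · congr 1
    grind [sin_sq_add_cos_sq (v θ), cosh_sq (u θ)]

end Rotation

/-! ### Invertibility and the maximum principle -/

theorem segment_exp_ne_zero {w : ℂ} (hw : |w.im| < π) {t : ℝ} (ht : t ∈ Icc (0 : ℝ) 1) :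
    (1 - t + t * Complex.exp w : ℂ) ≠ 0 := by
  have him := abs_lt.1 hw
  have hexp : Complex.exp w ∈ Complex.slitPlane := by
    rw [Complex.exp_mem_slitPlane, (toIocMod_eq_self _).2 ⟨him.1, by linarith⟩]
    exact him.2.ne
  have hseg := Complex.starConvex_one_slitPlane hexp (sub_nonneg.2 ht.2) ht.1 (sub_add_cancel 1 t)
  simpa using Complex.slitPlane_ne_zero hseg

section Disc

variable {p : ℝ}

theorem abs_im_lt_pi (hp : p < π) {w : ℂ} (hw : w ∈ Metric.closedBall 0 p) : |w.im| < π :=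
  (Complex.abs_im_le_norm w).trans_lt ((mem_closedBall_zero_iff.1 hw).trans_lt hp)

theorem exists_pos_le_norm_segment_exp (hp : p < π) :
    ∃ c > 0, ∀ t ∈ Icc (0 : ℝ) 1, ∀ w ∈ Metric.closedBall (0 : ℂ) p,
      c ≤ ‖(1 - t + t * Complex.exp w : ℂ)‖ := by
  have hcompact : IsCompact (Icc (0 : ℝ) 1 ×ˢ Metric.closedBall (0 : ℂ) p) :=
    isCompact_Icc.prod (isCompact_closedBall 0 p)
  obtain ⟨c, hc, hle⟩ := hcompact.exists_forall_le'
    (f := fun q => ‖(1 - q.1 + q.1 * Complex.exp q.2 : ℂ)‖) (a := 0) (by fun_prop)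
    fun q hq => norm_pos_iff.2 (segment_exp_ne_zero (abs_im_lt_pi hp hq.2) hq.1)
  exact ⟨c, hc, fun t ht w hw => hle (t, w) ⟨ht, hw⟩⟩

theorem cos_im_lt_cosh_re (h0 : 0 < p) (hp : p < π) {w : ℂ} (hw : w ∈ Metric.sphere 0 p) :
    cos w.im < cosh w.re := by
  refine cos_lt_cosh ?_ (abs_im_lt_pi hp (Metric.sphere_subset_closedBall hw))
  have hne : w ≠ 0 := ne_zero_of_mem_sphere h0.ne' ⟨w, hw⟩
  contrapose! hne
  exact Complex.ext hne.1 hne.2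

theorem zeroDist_pos (h0 : 0 < p) (hp : p < π) {τ : ℝ} (hτ : τ ∈ Icc (-1 : ℝ) 1) :
    0 < zeroDist p τ := by
  have hne : ∀ w ∈ Metric.sphere (0 : ℂ) p, 1 - Complex.exp w ≠ 0 := fun w hw =>
    one_sub_exp_ne_zero (cos_im_lt_cosh_re h0 hp hw)
  have hcont : ContinuousOn segmentZero (Metric.sphere 0 p) :=
    .div (by fun_prop) (by fun_prop) hne
  have hclosed := ((isCompact_sphere (0 : ℂ) p).image_of_continuousOn hcont).isClosed
  refine (hclosed.notMem_iff_infDist_pos ((NormedSpace.sphere_nonempty.2 h0.le).image _)).1 ?_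
  rintro ⟨w, hw, hwτ⟩
  have ht : (τ + 1) / 2 ∈ Icc (0 : ℝ) 1 := ⟨by linarith [hτ.1], by linarith [hτ.2]⟩
  refine segment_exp_ne_zero (abs_im_lt_pi hp (Metric.sphere_subset_closedBall hw)) ht ?_
  have hzero := two_mul_segment_exp (hne w hw) ((τ + 1) / 2)
  rw [hwτ, mul_div_cancel₀ _ two_ne_zero, add_sub_cancel_right, sub_self, mul_zero] at hzero
  exact_mod_cast (mul_eq_zero.1 hzero).resolve_left two_ne_zero

theorem norm_exp_sub_one_mul_zeroDist_le (h0 : 0 < p) (hp : p < π) {t : ℝ}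
    (ht : t ∈ Icc (0 : ℝ) 1) {w : ℂ} (hw : w ∈ Metric.closedBall (0 : ℂ) p) :
    ‖Complex.exp w - 1‖ * zeroDist p (2 * t - 1) ≤ 2 * ‖(1 - t + t * Complex.exp w : ℂ)‖ := by
  have hdist : 0 < zeroDist p (2 * t - 1) :=
    zeroDist_pos h0 hp ⟨by linarith [ht.1], by linarith [ht.2]⟩
  have hclosure : closure (Metric.ball (0 : ℂ) p) = Metric.closedBall 0 p := closure_ball _ h0.ne'
  have hne : ∀ z ∈ Metric.closedBall (0 : ℂ) p, (1 - t + t * Complex.exp z : ℂ) ≠ 0 :=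
    fun z hz => segment_exp_ne_zero (abs_im_lt_pi hp hz) ht
  have hdiff : DiffContOnCl ℂ (fun z => (Complex.exp z - 1) / (1 - t + t * Complex.exp z))
      (Metric.ball 0 p) := by
    refine DifferentiableOn.diffContOnCl (.div (by fun_prop) (by fun_prop) ?_)
    rwa [hclosure]
  have hsphere : ∀ z ∈ frontier (Metric.ball (0 : ℂ) p),
      ‖(Complex.exp z - 1) / (1 - t + t * Complex.exp z)‖ ≤ 2 / zeroDist p (2 * t - 1) := by
    intro z hz
    rw [frontier_ball _ h0.ne'] at hz
    rw [norm_div, div_le_div_iff₀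
      (norm_pos_iff.2 (hne z (Metric.sphere_subset_closedBall hz))) hdist]
    exact norm_exp_sub_one_mul_zeroDist_le_of_mem_sphere hz t
  have hmax := Complex.norm_le_of_forall_mem_frontier_norm_le Metric.isBounded_ball hdiff hsphere
    (hclosure ▸ hw)
  rwa [norm_div, div_le_div_iff₀ (norm_pos_iff.2 (hne w hw)) hdist] at hmax

theorem continuousOn_inv_zeroDist (h0 : 0 < p) (hp : p < π) :
    ContinuousOn (fun τ => (zeroDist p τ)⁻¹) (Icc (-1) 1) :=
  (continuous_zeroDist p).continuousOn.inv₀ fun _ hτ => (zeroDist_pos h0 hp hτ).ne'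

/-! ### The distance from the real line to the curve of zeros -/

/-- The real point on the normal to the curve of zeros at the parameter `p * exp (θ * I)`. -/
def circleFoot (p θ : ℝ) : ℝ :=
  normalFoot (p * cos θ) (p * sin θ)

theorem exists_re_eq_norm_mul_cos (w : ℂ) :
    ∃ θ ∈ Icc 0 π, w.re = ‖w‖ * cos θ ∧ |w.im| = ‖w‖ * sin θ := by
  refine ⟨|w.arg|, ⟨abs_nonneg _, Complex.abs_arg_le_pi w⟩, ?_, ?_⟩
  · rw [cos_abs, Complex.norm_mul_cos_arg]
  · rw [← abs_sin_eq_sin_abs_of_abs_le_pi (Complex.abs_arg_le_pi w), ← Complex.norm_mul_sin_arg,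
      abs_mul, abs_norm]

theorem abs_mul_sin_lt_pi (h0 : 0 < p) (hp : p < π) (θ : ℝ) : |p * sin θ| < π := by
  rw [abs_mul, abs_of_pos h0]
  exact (mul_le_of_le_one_right h0.le (abs_sin_le_one θ)).trans_lt hp

theorem mul_cos_sq_add_mul_sin_sq (p θ : ℝ) : (p * cos θ) ^ 2 + (p * sin θ) ^ 2 = p ^ 2 := by
  linear_combination p ^ 2 * sin_sq_add_cos_sq θ

theorem mul_cos_ne_zero_or (h0 : 0 < p) (θ : ℝ) : p * cos θ ≠ 0 ∨ p * sin θ ≠ 0 := by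
  by_contra! h
  have hsq := mul_cos_sq_add_mul_sin_sq p θ
  rw [h.1, h.2] at hsq
  exact (pow_pos h0 2).ne (by linarith)

theorem mul_sin_pos (h0 : 0 < p) {θ : ℝ} (hθ : θ ∈ Ioo 0 π) : 0 < p * sin θ :=
  mul_pos h0 (sin_pos_of_mem_Ioo hθ)

theorem cos_lt_cosh_circle (h0 : 0 < p) (hp : p < π) (θ : ℝ) :
    cos (p * sin θ) < cosh (p * cos θ) :=
  cos_lt_cosh (mul_cos_ne_zero_or h0 θ) (abs_mul_sin_lt_pi h0 hp θ)

theorem normalFootDen_circle_pos (h0 : 0 < p) (hp : p < π) (θ : ℝ) :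
    0 < normalFootDen (p * cos θ) (p * sin θ) :=
  normalFootDen_pos (mul_cos_ne_zero_or h0 θ) (abs_mul_sin_lt_pi h0 hp θ)

theorem hasDerivAt_mul_cos (p θ : ℝ) : HasDerivAt (fun s => p * cos s) (-(p * sin θ)) θ := by
  simpa using (hasDerivAt_cos θ).const_mul p

theorem hasDerivAt_mul_sin (p θ : ℝ) : HasDerivAt (fun s => p * sin s) (p * cos θ) θ :=
  (hasDerivAt_sin θ).const_mul p

theorem circleFoot_zero (p : ℝ) : circleFoot p 0 = normalFoot p 0 := by
  rw [circleFoot, cos_zero, sin_zero, mul_one, mul_zero]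

theorem circleFoot_pi (p : ℝ) : circleFoot p π = -circleFoot p 0 := by
  rw [circleFoot_zero, ← normalFoot_neg, circleFoot, cos_pi, sin_pi, mul_neg_one, mul_zero]

theorem continuous_circleFoot (h0 : 0 < p) (hp : p < π) : Continuous (circleFoot p) := by
  have hden := fun θ => (normalFootDen_circle_pos h0 hp θ).ne'
  unfold circleFoot normalFoot
  refine Continuous.div ?_ ?_ hden
  · unfold normalFootNum
    fun_prop
  · unfold normalFootDen
    fun_prop

theorem hasDerivAt_circleFoot (h0 : 0 < p) (hp : p < π) {θ : ℝ} (hθ : θ ∈ Ioo 0 π) :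
    HasDerivAt (circleFoot p)
      (p ^ 2 * (cosh (p * cos θ) - cos (p * sin θ)) * (sin (p * sin θ) - p * sin θ *
        cos (p * sin θ)) / (p * sin θ * normalFootDen (p * cos θ) (p * sin θ)) ^ 2) θ := by
  have h := hasDerivAt_normalFoot (u := fun s => p * cos s) (v := fun s => p * sin s)
    (hasDerivAt_mul_cos p θ) (hasDerivAt_mul_sin p θ) (mul_sin_pos h0 hθ).ne'
    (abs_mul_sin_lt_pi h0 hp θ)
  rwa [mul_cos_sq_add_mul_sin_sq] at h

theorem deriv_circleFoot_pos (h0 : 0 < p) (hp : p < π) {θ : ℝ} (hθ : θ ∈ Ioo 0 π) :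
    0 < deriv (circleFoot p) θ := by
  have hv := mul_sin_pos h0 hθ
  have hcos := sub_pos.2 (cos_lt_cosh_circle h0 hp θ)
  have hsin : 0 < sin (p * sin θ) - p * sin θ * cos (p * sin θ) := by
    rw [← mul_sinc, ← mul_sub]
    exact mul_pos hv (sub_pos.2 (cos_lt_sinc hv.ne' (abs_mul_sin_lt_pi h0 hp θ)))
  have hden := normalFootDen_circle_pos h0 hp θ
  rw [(hasDerivAt_circleFoot h0 hp hθ).deriv]
  positivity

theorem strictMonoOn_circleFoot (h0 : 0 < p) (hp : p < π) :
    StrictMonoOn (circleFoot p) (Icc 0 π) := by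
  refine strictMonoOn_of_deriv_pos (convex_Icc 0 π) (continuous_circleFoot h0 hp).continuousOn ?_
  rw [interior_Icc]
  exact fun θ hθ => deriv_circleFoot_pos h0 hp hθ

theorem zeroDist_eq_sqrt_distSq (h0 : 0 < p) (hp : p < π) {τ θ : ℝ}
    (hmin : IsMinOn (fun s => distSq τ (p * cos s) (p * sin s)) (Icc 0 π) θ) :
    zeroDist p τ = √(distSq τ (p * cos θ) (p * sin θ)) := by
  refine le_antisymm ?_ ?_
  · have hw : (⟨p * cos θ, p * sin θ⟩ : ℂ) ∈ Metric.sphere 0 p := by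
      rw [mem_sphere_zero_iff_norm, ← sq_eq_sq₀ (norm_nonneg _) h0.le, Complex.sq_norm,
        Complex.normSq_mk, ← sq, ← sq, mul_cos_sq_add_mul_sin_sq]
    refine (Metric.infDist_le_dist_of_mem (mem_image_of_mem segmentZero hw)).trans_eq ?_
    rw [dist_eq_norm, ← norm_ofReal_sub_segmentZero_sq τ (cos_im_lt_cosh_re h0 hp hw),
      sqrt_sq (norm_nonneg _)]
  · refine (Metric.le_infDist ((NormedSpace.sphere_nonempty.2 h0.le).image _)).2 ?_
    rintro _ ⟨w, hw, rfl⟩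
    obtain ⟨s, hs, hre, him⟩ := exists_re_eq_norm_mul_cos w
    rw [mem_sphere_zero_iff_norm.1 hw] at hre him
    have hdist : distSq τ (p * cos s) (p * sin s) = distSq τ w.re w.im := by
      rw [← hre, ← him, distSq, cos_abs, distSq]
    rw [dist_eq_norm]
    refine sqrt_le_iff.2 ⟨norm_nonneg _, ?_⟩
    rw [norm_ofReal_sub_segmentZero_sq τ (cos_im_lt_cosh_re h0 hp hw), ← hdist]
    exact hmin hs

theorem isMinOn_distSq (h0 : 0 < p) (hp : p < π) {τ θ : ℝ}
    (hle : ∀ s ∈ Ioo 0 θ, circleFoot p s ≤ τ) (hge : ∀ s ∈ Ioo θ π, τ ≤ circleFoot p s)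
    (hθ : θ ∈ Icc 0 π) :
    IsMinOn (fun s => distSq τ (p * cos s) (p * sin s)) (Icc 0 π) θ := by
  have hderiv : ∀ s, HasDerivAt (fun s => distSq τ (p * cos s) (p * sin s))
      (2 * (p * sin s) * normalFootDen (p * cos s) (p * sin s) * (circleFoot p s - τ)
        / (cosh (p * cos s) - cos (p * sin s)) ^ 2) s := fun s => by
    have hden := (normalFootDen_circle_pos h0 hp s).ne'
    have h := hasDerivAt_distSq (u := fun s => p * cos s) (v := fun s => p * sin s)
      (hasDerivAt_mul_cos p s) (hasDerivAt_mul_sin p s) (cos_lt_cosh_circle h0 hp s) τ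
    refine h.congr_deriv ?_
    rw [circleFoot, normalFoot]
    field_simp
  have hpos : ∀ s ∈ Ioo 0 π, 0 ≤ 2 * (p * sin s) * normalFootDen (p * cos s) (p * sin s) :=
    fun s hs => mul_nonneg (mul_pos two_pos (mul_sin_pos h0 hs)).le
      (normalFootDen_circle_pos h0 hp s).le
  refine isMinOn_Icc_of_deriv (hderiv 0).continuousAt (hderiv θ).continuousAt
    (hderiv π).continuousAt (fun s _ => (hderiv s).differentiableAt.differentiableWithinAt)
    (fun s _ => (hderiv s).differentiableAt.differentiableWithinAt) ?_ ?_ <;> intro s hs <;>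
    rw [(hderiv s).deriv]
  · exact div_nonpos_of_nonpos_of_nonneg (mul_nonpos_of_nonneg_of_nonpos
      (hpos s ⟨hs.1, hs.2.trans_le hθ.2⟩) (sub_nonpos.2 (hle s hs))) (sq_nonneg _)
  · exact div_nonneg (mul_nonneg (hpos s ⟨hθ.1.trans_lt hs.1, hs.2⟩)
      (sub_nonneg.2 (hge s hs))) (sq_nonneg _)

theorem zeroDist_circleFoot (h0 : 0 < p) (hp : p < π) {θ : ℝ} (hθ : θ ∈ Icc 0 π) :
    zeroDist p (circleFoot p θ)
      = p * sinc (p * sin θ) / normalFootDen (p * cos θ) (p * sin θ) := by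
  have hmono := (strictMonoOn_circleFoot h0 hp).monotoneOn
  have hsinc := sinc_pos (abs_mul_sin_lt_pi h0 hp θ)
  have hden := normalFootDen_circle_pos h0 hp θ
  rw [zeroDist_eq_sqrt_distSq h0 hp (isMinOn_distSq h0 hp
      (fun s hs => hmono ⟨hs.1.le, hs.2.le.trans hθ.2⟩ hθ hs.2.le)
      (fun s hs => hmono hθ ⟨hθ.1.trans hs.1.le, hs.2.le⟩ hs.1.le) hθ),
    circleFoot, distSq_normalFoot (mul_cos_ne_zero_or h0 θ) (abs_mul_sin_lt_pi h0 hp θ),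
    mul_cos_sq_add_mul_sin_sq, ← mul_pow, sqrt_sq (by positivity), mul_div_assoc]

/-! ### The integral of the inverse distance -/

theorem sinh_half_pos (h0 : 0 < p) : 0 < sinh (p / 2) :=
  sinh_pos_iff.2 (half_pos h0)

theorem cosh_sub_one (x : ℝ) : cosh x - 1 = 2 * sinh (x / 2) ^ 2 := by
  have h := cosh_two_mul (x / 2)
  rw [mul_div_cancel₀ x two_ne_zero, cosh_sq] at h
  linear_combination h

theorem sinh_eq_two_mul_sinh_half_mul (x : ℝ) : sinh x = 2 * sinh (x / 2) * cosh (x / 2) := by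
  rw [← sinh_two_mul, mul_div_cancel₀ x two_ne_zero]

theorem distSq_zero_right (h0 : 0 < p) (τ : ℝ) :
    distSq τ p 0 = (cosh (p / 2) / sinh (p / 2) + τ) ^ 2 := by
  have hcosh : cosh p + 1 = 2 * cosh (p / 2) ^ 2 := by
    linear_combination cosh_sub_one p - 2 * cosh_sq (p / 2)
  rw [distSq, cos_zero, add_assoc, hcosh, cosh_sub_one, sinh_eq_two_mul_sinh_half_mul]
  field_simp [(sinh_half_pos h0).ne']
  ring

theorem coth_half_sub_one (h0 : 0 < p) :
    cosh (p / 2) / sinh (p / 2) - 1 = exp (-(p / 2)) / sinh (p / 2) := by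
  rw [← cosh_sub_sinh, sub_div, div_self (sinh_half_pos h0).ne']

theorem normalFootDen_zero_right (h0 : 0 < p) :
    normalFootDen p 0 = p * sinh (p / 2) * HlogArg p := by
  rw [normalFootDen, HlogArg, cos_zero, sinc_zero, sinh_eq_two_mul_sinh_half_mul]
  field_simp
  linear_combination -cosh_sub_one p

theorem normalFootDen_zero_right_pos (h0 : 0 < p) : 0 < normalFootDen p 0 :=
  normalFootDen_pos (.inl h0.ne') (abs_zero.trans_lt pi_pos)

theorem HlogArg_pos (h0 : 0 < p) : 0 < HlogArg p := by
  have h := normalFootDen_zero_right_pos h0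
  rw [normalFootDen_zero_right h0] at h
  exact pos_of_mul_pos_right h (mul_pos h0 (sinh_half_pos h0)).le

theorem neg_one_le_circleFoot_zero (h0 : 0 < p) : -1 ≤ circleFoot p 0 := by
  have hsum : normalFootNum p 0 + normalFootDen p 0 = 1 - (p + 1) * exp (-p) := by
    rw [normalFootNum, normalFootDen, ← cosh_sub_sinh, cos_zero, sinc_zero]
    ring
  have hexp : (p + 1) * exp (-p) ≤ 1 :=
    calc (p + 1) * exp (-p) ≤ exp p * exp (-p) := by gcongr; exact add_one_le_exp p
      _ = 1 := by rw [← exp_add, add_neg_cancel, exp_zero]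
  rw [circleFoot_zero, normalFoot, le_div_iff₀ (normalFootDen_zero_right_pos h0)]
  linarith

theorem circleFoot_zero_mem (h0 : 0 < p) (hp : p < π) : circleFoot p 0 ∈ Icc (-1) 1 := by
  have hlt := strictMonoOn_circleFoot h0 hp ⟨le_rfl, pi_pos.le⟩ ⟨pi_pos.le, le_rfl⟩ pi_pos
  rw [circleFoot_pi] at hlt
  exact ⟨neg_one_le_circleFoot_zero h0, by linarith⟩

theorem circleFoot_pi_mem (h0 : 0 < p) (hp : p < π) : circleFoot p π ∈ Icc (-1) 1 := by
  have hmem := circleFoot_zero_mem h0 hp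
  rw [circleFoot_pi]
  exact ⟨neg_le_neg hmem.2, neg_le.1 hmem.1⟩

theorem zeroDist_of_le (h0 : 0 < p) (hp : p < π) {τ : ℝ} (hτ : -1 ≤ τ)
    (hfoot : τ ≤ circleFoot p 0) : zeroDist p τ = cosh (p / 2) / sinh (p / 2) + τ := by
  have hzero : (0 : ℝ) ∈ Icc 0 π := ⟨le_rfl, pi_pos.le⟩
  have hmin := isMinOn_distSq h0 hp (τ := τ) (by simp)
    (fun s hs => hfoot.trans ((strictMonoOn_circleFoot h0 hp).monotoneOn hzero
      (Ioo_subset_Icc_self hs) hs.1.le)) hzero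
  have hcoth := coth_half_sub_one h0
  have hpos := div_pos (exp_pos (-(p / 2))) (sinh_half_pos h0)
  rw [zeroDist_eq_sqrt_distSq h0 hp hmin, cos_zero, sin_zero, mul_one, mul_zero,
    distSq_zero_right h0, sqrt_sq]
  linarith

theorem zeroDist_circleFoot_zero (h0 : 0 < p) (hp : p < π) :
    zeroDist p (circleFoot p 0) = (sinh (p / 2) * HlogArg p)⁻¹ := by
  rw [zeroDist_circleFoot h0 hp ⟨le_rfl, pi_pos.le⟩, cos_zero, sin_zero, mul_one, mul_zero,
    sinc_zero, normalFootDen_zero_right h0, mul_assoc p, div_mul_eq_div_div,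
    mul_one, div_self h0.ne', one_div]

theorem integral_inv_zeroDist_left (h0 : 0 < p) (hp : p < π) :
    ∫ τ in (-1)..circleFoot p 0, (zeroDist p τ)⁻¹ = p / 2 - log (HlogArg p) := by
  have hfoot := neg_one_le_circleFoot_zero h0
  have hsinh := sinh_half_pos h0
  have hlog := HlogArg_pos h0
  have hleft : cosh (p / 2) / sinh (p / 2) + -1 = exp (-(p / 2)) / sinh (p / 2) :=
    coth_half_sub_one h0
  have hright : cosh (p / 2) / sinh (p / 2) + circleFoot p 0
      = (sinh (p / 2) * HlogArg p)⁻¹ := by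
    rw [← zeroDist_of_le h0 hp hfoot le_rfl, zeroDist_circleFoot_zero h0 hp]
  have hcongr : EqOn (fun τ => (zeroDist p τ)⁻¹)
      (fun τ => (cosh (p / 2) / sinh (p / 2) + τ)⁻¹) (uIcc (-1) (circleFoot p 0)) := by
    intro τ hτ
    rw [uIcc_of_le hfoot] at hτ
    exact congrArg _ (zeroDist_of_le h0 hp hτ.1 hτ.2)
  have hratio : (sinh (p / 2) * HlogArg p)⁻¹ / (exp (-(p / 2)) / sinh (p / 2))
      = exp (p / 2) / HlogArg p := by
    rw [exp_neg]
    field_simp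
  rw [intervalIntegral.integral_congr hcongr,
    intervalIntegral.integral_comp_add_left (fun x => x⁻¹), hleft, hright,
    integral_inv_of_pos (by positivity) (by positivity), hratio,
    log_div (exp_pos _).ne' hlog.ne', log_exp]

theorem integral_inv_zeroDist_right (p : ℝ) :
    ∫ τ in circleFoot p π..1, (zeroDist p τ)⁻¹
      = ∫ τ in (-1)..circleFoot p 0, (zeroDist p τ)⁻¹ := by
  rw [← neg_neg (circleFoot p 0), ← circleFoot_pi,
    ← intervalIntegral.integral_comp_neg (fun τ => (zeroDist p τ)⁻¹)]
  simp only [zeroDist_neg]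

theorem mul_HHden (p θ : ℝ) :
    p * HHden p θ
      = 2 * sin (p * sin θ) * (p * sin θ * normalFootDen (p * cos θ) (p * sin θ)) := by
  rw [mul_normalFootDen, HHden, sin_add, sin_add, sin_neg, cos_neg, ← cosh_add_sinh,
    ← cosh_sub_sinh]
  ring

theorem sin_mul_sin_pos (h0 : 0 < p) (hp : p < π) {θ : ℝ} (hθ : θ ∈ Ioo 0 π) :
    0 < sin (p * sin θ) :=
  sin_pos_of_pos_of_lt_pi (mul_sin_pos h0 hθ) (abs_lt.1 (abs_mul_sin_lt_pi h0 hp θ)).2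

theorem HHden_pos (h0 : 0 < p) (hp : p < π) {θ : ℝ} (hθ : θ ∈ Ioo 0 π) : 0 < HHden p θ := by
  refine pos_of_mul_pos_right (a := p) ?_ h0.le
  rw [mul_HHden]
  exact mul_pos (mul_pos two_pos (sin_mul_sin_pos h0 hp hθ))
    (mul_pos (mul_sin_pos h0 hθ) (normalFootDen_circle_pos h0 hp θ))

theorem HH_eq_deriv_circleFoot_mul (h0 : 0 < p) (hp : p < π) {θ : ℝ} (hθ : θ ∈ Ioo 0 π) :
    HH p θ = deriv (circleFoot p) θ * (zeroDist p (circleFoot p θ))⁻¹ := by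
  have hsin := sin_mul_sin_pos h0 hp hθ
  have hv := mul_sin_pos h0 hθ
  have hden := normalFootDen_circle_pos h0 hp θ
  have hHHden : HHden p θ = 2 * sin (p * sin θ) *
      (p * sin θ * normalFootDen (p * cos θ) (p * sin θ)) / p := by
    rw [← mul_HHden, mul_div_cancel_left₀ _ h0.ne']
  rw [(hasDerivAt_circleFoot h0 hp hθ).deriv, zeroDist_circleFoot h0 hp (Ioo_subset_Icc_self hθ),
    sinc_of_ne_zero hv.ne', HH, hHHden, cosh_eq]
  generalize p * sin θ = v at *
  field_simp

theorem HH_pos (h0 : 0 < p) (hp : p < π) {θ : ℝ} (hθ : θ ∈ Ioo 0 π) : 0 < HH p θ := by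
  have hden := normalFootDen_circle_pos h0 hp θ
  have hsinc := sinc_pos (abs_mul_sin_lt_pi h0 hp θ)
  rw [HH_eq_deriv_circleFoot_mul h0 hp hθ, zeroDist_circleFoot h0 hp (Ioo_subset_Icc_self hθ)]
  exact mul_pos (deriv_circleFoot_pos h0 hp hθ) (by positivity)

theorem intervalIntegrable_inv_zeroDist (h0 : 0 < p) (hp : p < π) {a b : ℝ}
    (ha : a ∈ Icc (-1) 1) (hb : b ∈ Icc (-1) 1) :
    IntervalIntegrable (fun τ => (zeroDist p τ)⁻¹) MeasureTheory.volume a b :=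
  ((continuousOn_inv_zeroDist h0 hp).mono
    (ordConnected_Icc.uIcc_subset ha hb)).intervalIntegrable

theorem hasDerivAt_circleFoot_of_mem_uIoo (h0 : 0 < p) (hp : p < π) :
    ∀ θ ∈ uIoo 0 π, HasDerivAt (circleFoot p) (deriv (circleFoot p) θ) θ := by
  rw [uIoo_of_le pi_pos.le]
  exact fun θ hθ => (hasDerivAt_circleFoot h0 hp hθ).differentiableAt.hasDerivAt

theorem deriv_circleFoot_nonneg_of_mem_uIoo (h0 : 0 < p) (hp : p < π) :
    ∀ θ ∈ uIoo 0 π, 0 ≤ deriv (circleFoot p) θ := by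
  rw [uIoo_of_le pi_pos.le]
  exact fun θ hθ => (deriv_circleFoot_pos h0 hp hθ).le

theorem eqOn_deriv_smul_comp_HH (h0 : 0 < p) (hp : p < π) :
    EqOn (fun θ => deriv (circleFoot p) θ • ((fun τ => (zeroDist p τ)⁻¹) ∘ circleFoot p) θ) (HH p)
      (uIoo 0 π) := by
  rw [uIoo_of_le pi_pos.le]
  exact fun θ hθ => (HH_eq_deriv_circleFoot_mul h0 hp hθ).symm

theorem intervalIntegrable_HH (h0 : 0 < p) (hp : p < π) :
    IntervalIntegrable (HH p) MeasureTheory.volume 0 π :=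
  ((intervalIntegral.integrable_deriv_smul_comp_iff_of_deriv_nonneg
    (continuous_circleFoot h0 hp).continuousOn (hasDerivAt_circleFoot_of_mem_uIoo h0 hp)
    (deriv_circleFoot_nonneg_of_mem_uIoo h0 hp)).2 (intervalIntegrable_inv_zeroDist h0 hp
      (circleFoot_zero_mem h0 hp) (circleFoot_pi_mem h0 hp))).congr_uIoo
        (eqOn_deriv_smul_comp_HH h0 hp)

theorem integral_inv_zeroDist_middle (h0 : 0 < p) (hp : p < π) :
    ∫ τ in circleFoot p 0..circleFoot p π, (zeroDist p τ)⁻¹ = ∫ θ in 0..π, HH p θ := by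
  rw [← intervalIntegral.integral_congr_uIoo (eqOn_deriv_smul_comp_HH h0 hp)]
  exact (intervalIntegral.integral_deriv_smul_comp_of_deriv_nonneg
    (continuous_circleFoot h0 hp).continuousOn (hasDerivAt_circleFoot_of_mem_uIoo h0 hp)
    (deriv_circleFoot_nonneg_of_mem_uIoo h0 hp)).symm

theorem integral_inv_zeroDist (h0 : 0 < p) (hp : p < π) :
    ∫ τ in (-1)..1, (zeroDist p τ)⁻¹ = H p := by
  have hint := fun {a b : ℝ} => intervalIntegrable_inv_zeroDist h0 hp (a := a) (b := b)
  have hleft : (-1 : ℝ) ∈ Icc (-1 : ℝ) 1 := left_mem_Icc.2 (by norm_num)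
  have hright : (1 : ℝ) ∈ Icc (-1 : ℝ) 1 := right_mem_Icc.2 (by norm_num)
  have hfoot0 := circleFoot_zero_mem h0 hp
  have hfootπ := circleFoot_pi_mem h0 hp
  rw [← intervalIntegral.integral_add_adjacent_intervals (hint hleft hfoot0) (hint hfoot0 hright),
    ← intervalIntegral.integral_add_adjacent_intervals (hint hfoot0 hfootπ) (hint hfootπ hright),
    integral_inv_zeroDist_right, integral_inv_zeroDist_left h0 hp,
    integral_inv_zeroDist_middle h0 hp, H]
  ring

theorem H_pos (h0 : 0 < p) (hp : p < π) : 0 < H p := by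
  rw [← integral_inv_zeroDist h0 hp]
  exact intervalIntegral.intervalIntegral_pos_of_pos_on
    (intervalIntegrable_inv_zeroDist h0 hp (by simp) (by simp))
    (fun τ hτ => inv_pos.2 (zeroDist_pos h0 hp (Ioo_subset_Icc_self hτ))) (by norm_num)

/-! ### Operators with conformal range in `exp '' closedBall 0 p` -/

variable {𝕜 E : Type*} [RCLike 𝕜] [NormedAddCommGroup E] [InnerProductSpace 𝕜 E]

theorem isLogable_of_conformalRange_subset [CompleteSpace E] (hp : p < π) {A : E →L[𝕜] E}
    (hA : conformalRange A ⊆ Complex.exp '' Metric.closedBall 0 p) : IsLogable A := by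
  obtain ⟨c, hc, hle⟩ := exists_pos_le_norm_segment_exp hp
  refine isLogable_of_bounded_below A hc fun t ht x => ?_
  rcases eq_or_ne x 0 with rfl | hx
  · simp
  obtain ⟨w, hw, hwx⟩ := hA (ratio_mem_conformalRange A hx)
  rw [norm_segmentPoint_apply A t hx, ← hwx]
  exact mul_le_mul_of_nonneg_right (hle t ht w hw) (norm_nonneg x)

theorem norm_sub_one_apply_le_of_conformalRange_subset (h0 : 0 < p) (hp : p < π) {A : E →L[𝕜] E}
    (hA : conformalRange A ⊆ Complex.exp '' Metric.closedBall 0 p) {t : ℝ}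
    (ht : t ∈ Icc (0 : ℝ) 1) (x : E) :
    ‖(A - 1) x‖ ≤ 2 * (zeroDist p (2 * t - 1))⁻¹ * ‖segmentPoint A t x‖ := by
  have hdist := zeroDist_pos h0 hp (τ := 2 * t - 1) ⟨by linarith [ht.1], by linarith [ht.2]⟩
  rcases eq_or_ne x 0 with rfl | hx
  · simp
  obtain ⟨w, hw, hwx⟩ := hA (ratio_mem_conformalRange A hx)
  rw [norm_segmentPoint_apply A t hx, norm_sub_one_apply A hx, ← hwx, ← mul_assoc]
  refine mul_le_mul_of_nonneg_right ?_ (norm_nonneg x)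
  rw [mul_right_comm, ← div_eq_mul_inv, le_div_iff₀ hdist]
  exact norm_exp_sub_one_mul_zeroDist_le h0 hp ht hw

theorem norm_opLog_le_of_conformalRange_subset [CompleteSpace E] (h0 : 0 < p) (hp : p < π)
    {A : E →L[𝕜] E} (hA : conformalRange A ⊆ Complex.exp '' Metric.closedBall 0 p) :
    ‖opLog A‖ ≤ H p := by
  have hmem : ∀ t ∈ Icc (0 : ℝ) 1, 2 * t - 1 ∈ Icc (-1 : ℝ) 1 := fun t ht =>
    ⟨by linarith [ht.1], by linarith [ht.2]⟩
  have hint : IntervalIntegrable (fun t => 2 * (zeroDist p (2 * t - 1))⁻¹)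
      MeasureTheory.volume 0 1 := by
    refine ContinuousOn.intervalIntegrable ?_
    rw [uIcc_of_le zero_le_one]
    exact continuousOn_const.mul
      ((continuousOn_inv_zeroDist h0 hp).comp (f := fun t => 2 * t - 1) (by fun_prop) hmem)
  have hH : ∫ t in (0 : ℝ)..1, 2 * (zeroDist p (2 * t - 1))⁻¹ = H p := by
    rw [intervalIntegral.integral_const_mul, ← smul_eq_mul,
      intervalIntegral.smul_integral_comp_mul_sub (fun τ => (zeroDist p τ)⁻¹),
      ← integral_inv_zeroDist h0 hp]
    norm_num
  rw [← hH]
  exact norm_opLog_le A (isLogable_of_conformalRange_subset hp hA) hint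
    (fun t ht => mul_nonneg zero_le_two (inv_nonneg.2 (zeroDist_pos h0 hp (hmem t ht)).le))
    fun t ht => norm_sub_one_apply_le_of_conformalRange_subset h0 hp hA ht

end Disc

end

end ConformalRange

/-- For a bounded operator `A` on a real or complex Hilbert space whose conformal range lies in
`exp D̄(0,p)`, `0 < p < π`, the logarithm exists and `‖log A‖ ≤ H(p)`; the same for `p = 0` with
`0` as the bound; and `H(p)`, `HH(p,t)` are well defined (no vanishing denominator, convergent
integral) and positive for `0 < p < π`, `0 < t < π`. -/
theorem mainTheorem2 {𝕜 E : Type*} [RCLike 𝕜] [NormedAddCommGroup E]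
    [InnerProductSpace 𝕜 E] [CompleteSpace E] :
    (∀ p : ℝ, 0 < p → p < Real.pi → ∀ A : E →L[𝕜] E,
      ConformalRange.conformalRange A ⊆ Complex.exp '' Metric.closedBall 0 p →
        ConformalRange.IsLogable A ∧ ‖ConformalRange.opLog A‖ ≤ ConformalRange.H p) ∧
    (∀ A : E →L[𝕜] E,
      ConformalRange.conformalRange A ⊆ Complex.exp '' Metric.closedBall 0 0 →
        ConformalRange.IsLogable A ∧ ‖ConformalRange.opLog A‖ ≤ 0) ∧
    (∀ p : ℝ, 0 < p → p < Real.pi →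
      (∀ t ∈ Set.Ioo 0 Real.pi,
        ConformalRange.HHden p t ≠ 0 ∧ 0 < ConformalRange.HH p t) ∧
      IntervalIntegrable (ConformalRange.HH p) MeasureTheory.volume 0 Real.pi ∧
      0 < ConformalRange.HlogArg p ∧
      0 < ConformalRange.H p) := by
  refine ⟨fun p h0 hp A hA => ⟨ConformalRange.isLogable_of_conformalRange_subset hp hA,
    ConformalRange.norm_opLog_le_of_conformalRange_subset h0 hp hA⟩, fun A hA => ?_,
    fun p h0 hp => ⟨fun t ht => ⟨(ConformalRange.HHden_pos h0 hp ht).ne',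
      ConformalRange.HH_pos h0 hp ht⟩, ConformalRange.intervalIntegrable_HH h0 hp,
      ConformalRange.HlogArg_pos h0, ConformalRange.H_pos h0 hp⟩⟩
  obtain rfl := ConformalRange.eq_one_of_conformalRange_subset A (by simpa using hA)
  exact ⟨ConformalRange.isLogable_one, by rw [ConformalRange.opLog_one, norm_zero]⟩
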